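/- Let $c>0$ (the case of interest is $c=5/4$), $\lambda_b>0$, $\alpha>2$, and let $K,N\ge 1$. The distances $d_1,\dots,d_{2K}$ of $2K$ users from their serving base station are independent and all follow the Rayleigh law with density $f_d(x)=2c\lambda_b\pi x\,e^{-c\lambda_b\pi x^2}$, $x\ge 0$, and distribution function $F_d$ (this is the usual approximation of the distance law in a Poisson network of base stations of intensity $\lambda_b$, taken here as the model). The $2K$ users are grouped into $K$ pairs uniformly at random, independently of the distances, and $d_{\tilde k}$ denotes the larger of the two distances in the $k$-th pair (the far user). Let $\sigma>0$ and $P>0$ (noise and transmit power $\sigma^2$, $P$), $\rho_I\ge 0$ (interference power), let $0\ne\mathbf u_{\tilde k}\in\mathbb C^N$ be the detection filter of the far user, $\ell(d)=d^{-\alpha}$ the path loss, and put $$\sigma_{\tilde k}^2=\sigma^2\|\mathbf u_{\tilde k}\|^2,\qquad \omega_{\tilde k}=\Gamma\!\left(1-\tfrac2\alpha\right)\left(\tfrac{\rho_I}{P}\,\bigl|\mathbf u_{\tilde k}^{\rm H}\mathbf 1_N\bigr|^2\right)^{2/\alpha}.$$ For $s\in\mathbb C$ with $\operatorname{Re}s>0$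 (principal branches of all powers) let $$\varphi_{\tilde k}(s)=\mathbb E\left\{\exp\!\left(-\frac{\sigma_{\tilde k}^2}{P\,\ell(d_{\tilde k})}\,s-\pi\lambda_b\,\omega_{\tilde k}\,d_{\tilde k}^2\,s^{2/\alpha}\right)\right\}.$$ Let $H^{1,1}_{1,1}$ be Fox's H-function; with the parameters used here, $$H_{1,1}^{1,1}\!\left(z\,\middle|\begin{array}{c}(0,\frac\alpha2)\\(0,1)\end{array}\right)=\frac1{2\pi\mathrm i}\int_{\gamma-\mathrm i\infty}^{\gamma+\mathrm i\infty}\Gamma(v)\,\Gamma\!\left(1-\tfrac\alpha2 v\right)z^{-v}\,dv,\qquad 0<\gamma<\tfrac2\alpha .$$ Then the following hold. 1. $F_d(x)=1-e^{-c\lambda_b\pi x^2}$ for $x\ge 0$, and $d_{\tilde k}$ has the density $2F_d(x)f_d(x)$. 2. For every $s$ with $\operatorname{Re}s>0$ the expectation exists, the two integrals defining the H-functions below converge absolutely and do not depend on $\gamma$, and $$\varphi_{\tilde k}(s)=\frac{2c}{c+\omega_{\tilde k}s^{2/\alpha}}\,H_{1,1}^{1,1}\!\left(\frac{\sigma_{\tilde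 k}^2}{P}\,s\,\bigl(\pi\lambda_b(c+\omega_{\tilde k}s^{2/\alpha})\bigr)^{-\alpha/2}\,\middle|\begin{array}{c}(0,\frac\alpha2)\\(0,1)\end{array}\right)-\frac{2c}{2c+\omega_{\tilde k}s^{2/\alpha}}\,H_{1,1}^{1,1}\!\left(\frac{\sigma_{\tilde k}^2}{P}\,s\,\bigl(\pi\lambda_b(2c+\omega_{\tilde k}s^{2/\alpha})\bigr)^{-\alpha/2}\,\middle|\begin{array}{c}(0,\frac\alpha2)\\(0,1)\end{array}\right).$$ 3. In the interference-limited regime $\sigma^2/P\to0$ with $\rho_I/P$ (hence $\omega_{\tilde k}$) fixed, $$\varphi_{\tilde k}(s)\;\longrightarrow\;\frac{2c}{c+\omega_{\tilde k}s^{2/\alpha}}-\frac{2c}{2c+\omega_{\tilde k}s^{2/\alpha}},$$ a limit that does not depend on $\lambda_b$. More generally, for fixed $s$, the difference between $\varphi_{\tilde k}(s)$ and the right-hand side tends to $0$ as $\sigma^2/P\to0$, uniformly in $P>0$ and $\rho_I\ge0$. -/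

import Mathlib

open MeasureTheory ProbabilityTheory Filter Topology
open scoped ENNReal

noncomputable section

/-! Fox's H-function -/

/-- The Mellin-Barnes kernel
`∏_{j ≤ m} Γ(b_j + B_j u) ∏_{j ≤ n} Γ(1 - a_j - A_j u) /
  (∏_{j > m} Γ(1 - b_j - B_j u) ∏_{j > n} Γ(a_j + A_j u))`
of `H^{m,n}_{p,q}`, with upper parameters `a j = (a_j, A_j)` and lower parameters
`b j = (b_j, B_j)`. The factors `1 / Γ` vanish at the poles of `Γ`. -/
def foxKernel (m n : ℕ) {p q : ℕ} (a : Fin p → ℂ × ℝ) (b : Fin q → ℂ × ℝ) (u : ℂ) : ℂ :=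
  (∏ j : Fin q, if (j : ℕ) < m then Complex.Gamma ((b j).1 + (b j).2 * u)
      else (Complex.Gamma (1 - (b j).1 - (b j).2 * u))⁻¹) *
  (∏ j : Fin p, if (j : ℕ) < n then Complex.Gamma (1 - (a j).1 - (a j).2 * u)
      else (Complex.Gamma ((a j).1 + (a j).2 * u))⁻¹)

/-- The vertical line `Re u = γ` separates the poles `-(b_j + ν) / B_j` (`j ≤ m`), which lie to its
left, from the poles `(1 - a_j + ν) / A_j` (`j ≤ n`), which lie to its right. -/
def FoxSeparates (m n : ℕ) {p q : ℕ} (a : Fin p → ℂ × ℝ) (b : Fin q → ℂ × ℝ) (γ : ℝ) : Prop :=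
  (∀ j : Fin q, (j : ℕ) < m → ∀ ν : ℕ, (-((b j).1 + ν) / (b j).2).re < γ) ∧
  (∀ j : Fin p, (j : ℕ) < n → ∀ ν : ℕ, γ < ((1 - (a j).1 + ν) / (a j).2).re)

/-- The integrand, in the real variable `t`, of the Mellin-Barnes integral
`(2 π i)⁻¹ ∫ Θ(u) z^{-u} du` along the line `u = γ + i t`. -/
def foxIntegrand (m n : ℕ) {p q : ℕ} (a : Fin p → ℂ × ℝ) (b : Fin q → ℂ × ℝ) (z : ℂ)
    (γ t : ℝ) : ℂ :=
  foxKernel m n a b (γ + t * Complex.I) * z ^ (-((γ : ℂ) + t * Complex.I)) * Complex.I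

/-- `H^{m,n}_{p,q}(z)` exists and has the value `h`: there is a separating vertical line, and
along every such line the Mellin-Barnes integral converges absolutely to `h`. -/
structure HasFoxH (m n : ℕ) {p q : ℕ} (a : Fin p → ℂ × ℝ) (b : Fin q → ℂ × ℝ) (z h : ℂ) :
    Prop where
  order : m ≤ q ∧ n ≤ p
  pos : (∀ j, 0 < (a j).2) ∧ (∀ j, 0 < (b j).2)
  ne_zero : z ≠ 0
  exists_line : ∃ γ : ℝ, FoxSeparates m n a b γ
  integrable : ∀ γ : ℝ, FoxSeparates m n a b γ → Integrable (foxIntegrand m n a b z γ)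
  eq : ∀ γ : ℝ, FoxSeparates m n a b γ →
    (2 * Real.pi * Complex.I)⁻¹ * ∫ t : ℝ, foxIntegrand m n a b z γ t = h

theorem HasFoxH.unique {m n p q : ℕ} {a : Fin p → ℂ × ℝ} {b : Fin q → ℂ × ℝ} {z h h' : ℂ}
    (H : HasFoxH m n a b z h) (H' : HasFoxH m n a b z h') : h = h' := by
  obtain ⟨γ, hγ⟩ := H.exists_line
  exact (H.eq γ hγ).symm.trans (H'.eq γ hγ)

open Classical in
/-- Fox's H-function `H^{m,n}_{p,q}(z | a ; b)` (and `0` where it does not exist). -/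
def foxH (m n : ℕ) {p q : ℕ} (a : Fin p → ℂ × ℝ) (b : Fin q → ℂ × ℝ) (z : ℂ) : ℂ :=
  if h : ∃ w, HasFoxH m n a b z w then h.choose else 0

/-! Distances and random grouping -/

/-- The Rayleigh density `f_d(x) = 2 c λ π x exp(-c λ π x²)`, `x ≥ 0`, of the distance between a
user and its serving base station. -/
def distancePDF (c lam x : ℝ) : ℝ :=
  if 0 ≤ x then 2 * c * lam * Real.pi * x * Real.exp (-(c * lam * Real.pi * x ^ 2)) else 0

/-- The law of the distance between a user and its serving base station. -/
def distanceLaw (c lam : ℝ) : Measure ℝ :=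
  volume.withDensity fun x => ENNReal.ofReal (distancePDF c lam x)

/-- The cumulative distribution function `F_d` of the distance. -/
def distanceCDF (c lam x : ℝ) : ℝ := cdf (distanceLaw c lam) x

/-- A grouping of `2K` users into `K` (labelled) pairs: the users `e (k, false)` and `e (k, true)`
form the `k`-th pair. -/
abbrev Grouping (K : ℕ) : Type := Fin K × Bool ≃ Fin (2 * K)

instance (K : ℕ) : MeasurableSpace (Grouping K) := ⊤

/-- The distance `d_{k̃}` of the far user of the `k`-th pair from the base station. -/
def farDistance {Ω : Type*} {K : ℕ} (G : Ω → Grouping K) (D : Fin (2 * K) → Ω → ℝ) (k : Fin K)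
    (w : Ω) : ℝ :=
  max (D (G w (k, false)) w) (D (G w (k, true)) w)

/-! The averaging term -/

/-- Path loss `ℓ(d) = d^{-α}`. -/
def pathLoss (α d : ℝ) : ℝ := d ^ (-α)

/-- The noise power `σ_{k̃}² = σ² ‖u‖²` behind the detection filter `u`. -/
def filteredNoise {N : ℕ} (σ : ℝ) (u : EuclideanSpace ℂ (Fin N)) : ℝ := σ ^ 2 * ‖u‖ ^ 2

/-- `ω_{k̃} = Γ(1 - 2/α) (r |uᴴ 1|²)^{2/α}`, where `r = ρ_I / P` is the ratio of the interference
power to the transmit power. -/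
def interferenceCoeff {N : ℕ} (α r : ℝ) (u : EuclideanSpace ℂ (Fin N)) : ℝ :=
  Real.Gamma (1 - 2 / α) * (r * ‖∑ i, star (u i)‖ ^ 2) ^ (2 / α)

/-- The integrand `exp(-σ_{k̃}² s / (P ℓ(d)) - π λ ω_{k̃} d² s^{2/α})` of the averaging term, as a
function of the distance `d` (principal branch of the power). -/
def averagingIntegrand {N : ℕ} (α lam σ P ρ : ℝ) (u : EuclideanSpace ℂ (Fin N)) (s : ℂ) (d : ℝ) :
    ℂ :=
  Complex.exp (-((filteredNoise σ u / (P * pathLoss α d) : ℝ) : ℂ) * s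
    - ((Real.pi * lam * interferenceCoeff α (ρ / P) u * d ^ 2 : ℝ) : ℂ) * s ^ ((2 / α : ℝ) : ℂ))

/-- The averaging term `φ_{k̃}(s)`: the expectation of the integrand over the random distance `d`. -/
def averagingTerm {Ω : Type*} [MeasurableSpace Ω] (μ : Measure Ω) (d : Ω → ℝ) {N : ℕ}
    (α lam σ P ρ : ℝ) (u : EuclideanSpace ℂ (Fin N)) (s : ℂ) : ℂ :=
  ∫ w, averagingIntegrand α lam σ P ρ u s (d w) ∂μ

/-- The argument `(σ_{k̃}² / P) s (π λ (c' + ω s^{2/α}))^{-α/2}` of the H-function. -/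
def foxArgument (α lam ν c' ω : ℝ) (s : ℂ) : ℂ :=
  (ν : ℂ) * s *
    ((Real.pi * lam : ℝ) * ((c' : ℂ) + ω * s ^ ((2 / α : ℝ) : ℂ))) ^ ((-(α / 2) : ℝ) : ℂ)

/-- The interference-limited expression
`2c / (c + ω s^{2/α}) - 2c / (2c + ω s^{2/α})`. -/
def interferenceLimitedTerm (α c ω : ℝ) (s : ℂ) : ℂ :=
  2 * c / (c + ω * s ^ ((2 / α : ℝ) : ℂ)) - 2 * c / (2 * c + ω * s ^ ((2 / α : ℝ) : ℂ))

/-- The regime `σ² / P → 0`, as a filter on the pairs `(σ, P)` of positive numbers. -/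
def interferenceLimited : Filter (ℝ × ℝ) :=
  comap (fun x : ℝ × ℝ => x.1 ^ 2 / x.2) (𝓝 0) ⊓ 𝓟 {x : ℝ × ℝ | 0 < x.1 ∧ 0 < x.2}

end

/-! Write `β = α / 2`, `w = (σ_{k̃}² / P) s` and `A_{c'} = π λ (c' + ω s^{2/α})`. For a fixed
grouping the two users of a pair are distinct, so the larger distance has distribution function
`F_d²`, hence density `2 F_d f_d`. In the variable `t = d²` this density becomes `2cλπ (e^{-cλπt} -
e^{-2cλπt}) dt`, and the averaging term becomes `2cλπ (L(A_c) - L(A_{2c}))`, where `L(A) = ∫₀^∞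
e^{-At} e^{-w t^β} dt` is `stretchedLaplace` (`averagingTerm_eq`).

To recognise `A L(A)` as the H-function at `w A^{-β}`, expand `e^{-w t^β}` by the Cahen-Mellin
integral and exchange the integrals; the `t`-integral is Euler's and produces `Γ(1 - βv) A^{βv - 1}`
(`integral_mellinBarnes`). Absolute convergence holds because `Γ(v) w^{-v}` decays exponentially on
vertical lines when `|arg w| < π/2`, while `Γ(1 - βv) A^{βv}` stays bounded there.

The delicate point is the branch: `(w A^{-β})^{-v} = w^{-v} A^{βv}` for principal powers needs
control of `arg w - β arg A`. Adding `c' > 0` to `ω s^{2/α}` only shrinks the argument, so `β |arg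
A| ≤ |arg s| < π/2` (`mul_abs_arg_lt_pi_div_two`).

For small noise, `|L(A) - 1/A| ≤ |w| ∫ t^β e^{-at} dt` whenever `0 < a ≤ Re A`. The choice `a = πλc`
does not involve `P` or `ρ_I`, which gives the uniform limit (`norm_averagingTerm_sub_le`). -/

/-! ### Euler's integral, vertical decay of Γ, and the Cahen-Mellin integral. -/

section GammaIntegrals

open Set Complex

lemma norm_cpow_mul_cexp_neg_mul {v A : ℂ} {t : ℝ} (ht : 0 < t) :
    ‖(t : ℂ) ^ v * cexp (-(A * t))‖ = t ^ v.re * Real.exp (-(A.re * t)) := by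
  rw [norm_mul, norm_cpow_eq_rpow_re_of_pos ht, norm_exp]
  simp

lemma integrableOn_rpow_mul_exp_neg_mul {s b : ℝ} (hs : -1 < s) (hb : 0 < b) :
    IntegrableOn (fun t : ℝ => t ^ s * Real.exp (-(b * t))) (Ioi 0) := by
  simpa using integrableOn_rpow_mul_exp_neg_mul_rpow hs one_pos hb

lemma aestronglyMeasurable_cpow_mul_cexp_neg_mul (v A : ℂ) :
    AEStronglyMeasurable (fun t : ℝ => (t : ℂ) ^ v * cexp (-(A * t)))
      (volume.restrict (Ioi 0)) := by
  refine (ContinuousOn.mul (fun t ht => ?_) (by fun_prop)).aestronglyMeasurable measurableSet_Ioi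
  exact (continuousAt_ofReal_cpow_const _ _ (Or.inr (ne_of_gt ht))).continuousWithinAt

lemma integrableOn_cpow_mul_cexp_neg_mul {v A : ℂ} (hv : -1 < v.re) (hA : 0 < A.re) :
    IntegrableOn (fun t : ℝ => (t : ℂ) ^ v * cexp (-(A * t))) (Ioi 0) :=
  (integrableOn_rpow_mul_exp_neg_mul hv hA).mono' (aestronglyMeasurable_cpow_mul_cexp_neg_mul v A)
    ((ae_restrict_iff' measurableSet_Ioi).2 <| .of_forall fun _ ht =>
      (norm_cpow_mul_cexp_neg_mul ht).le)

/-- Differentiation under the integral sign: on the half-plane `Re z > Re A / 2` the derivative of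
the integrand is dominated by `t^{Re v} e^{-(Re A / 2) t}`. -/
lemma differentiableAt_integral_cpow_mul_cexp_neg_mul {v A : ℂ} (hv : 0 < v.re) (hA : 0 < A.re) :
    DifferentiableAt ℂ
      (fun z : ℂ => ∫ t : ℝ in Ioi 0, (t : ℂ) ^ (v - 1) * cexp (-(z * t))) A := by
  have hs : {z : ℂ | A.re / 2 < z.re} ∈ 𝓝 A :=
    (isOpen_lt continuous_const continuous_re).mem_nhds (by simpa using hA)
  refine (hasDerivAt_integral_of_dominated_loc_of_deriv_le
    (F' := fun z t => (t : ℂ) ^ (v - 1) * (cexp (-(z * t)) * (-t)))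
    (bound := fun t => t ^ v.re * Real.exp (-(A.re / 2 * t))) hs
    (.of_forall fun z => aestronglyMeasurable_cpow_mul_cexp_neg_mul _ z)
    (integrableOn_cpow_mul_cexp_neg_mul (by simpa using hv) hA) ?_ ?_
    (integrableOn_rpow_mul_exp_neg_mul (by linarith) (by linarith)) ?_).2.differentiableAt
  · have := (aestronglyMeasurable_cpow_mul_cexp_neg_mul (v - 1) A).mul
      (Continuous.aestronglyMeasurable (f := fun t : ℝ => (-t : ℂ)) (by fun_prop))
    refine this.congr (.of_forall fun t => ?_)
    simp only [Pi.mul_apply]; ring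
  · refine (ae_restrict_iff' measurableSet_Ioi).2 (.of_forall fun t ht z hz => ?_)
    have ht' : 0 < t := ht
    rw [← mul_assoc, norm_mul, norm_cpow_mul_cexp_neg_mul ht', norm_neg, Complex.norm_of_nonneg ht'.le,
      mul_right_comm, sub_re, one_re]
    nth_rw 2 [← Real.rpow_one t]
    rw [← Real.rpow_add ht', sub_add_cancel]
    have hz' : A.re / 2 < z.re := hz
    gcongr
  · refine .of_forall fun t z _ => HasDerivAt.const_mul _ ?_
    have : HasDerivAt (fun z : ℂ => -(z * t)) (-t : ℂ) z := by
      simpa using ((hasDerivAt_id z).mul_const (t : ℂ)).fun_neg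
    exact this.cexp

/-- Euler's integral `∫ t ^ (v - 1) exp (-A t) dt = Γ(v) A ^ (-v)` in the right half-plane. -/
lemma integral_cpow_mul_cexp_neg_mul {v A : ℂ} (hv : 0 < v.re) (hA : 0 < A.re) :
    ∫ t : ℝ in Ioi 0, (t : ℂ) ^ (v - 1) * cexp (-(A * t)) = Gamma v * A ^ (-v) := by
  have hopen : IsOpen {z : ℂ | 0 < z.re} := isOpen_lt continuous_const continuous_re
  have hf : AnalyticOnNhd ℂ
      (fun z : ℂ => ∫ t : ℝ in Ioi 0, (t : ℂ) ^ (v - 1) * cexp (-(z * t))) {z | 0 < z.re} :=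
    DifferentiableOn.analyticOnNhd (fun z hz =>
      (differentiableAt_integral_cpow_mul_cexp_neg_mul hv hz).differentiableWithinAt) hopen
  have hg : AnalyticOnNhd ℂ (fun z : ℂ => Gamma v * z ^ (-v)) {z | 0 < z.re} :=
    DifferentiableOn.analyticOnNhd (fun z hz =>
      ((differentiableAt_id.cpow_const (Or.inl hz)).const_mul _).differentiableWithinAt) hopen
  have hconn : IsPreconnected {z : ℂ | 0 < z.re} := (convex_halfSpace_re_gt 0).isPreconnected
  -- Identity theorem: the formula is known on the positive reals, and the points `1 + 1/(n+1)`
  -- accumulate at `1`.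
  refine hf.eqOn_of_preconnected_of_frequently_eq hg hconn (z₀ := 1) (by simp) ?_ hA
  have hreal : ∀ r : ℝ, 0 < r →
      (∫ t : ℝ in Ioi 0, (t : ℂ) ^ (v - 1) * cexp (-((r : ℂ) * t))) = Gamma v * (r : ℂ) ^ (-v) := by
    intro r hr
    rw [integral_cpow_mul_exp_neg_mul_Ioi hv hr, one_div, inv_cpow _ _ ?_, cpow_neg, mul_comm]
    rw [arg_ofReal_of_nonneg hr.le]
    exact Real.pi_pos.ne
  have htend : Tendsto (fun n : ℕ => ((1 + 1 / ((n : ℝ) + 1) : ℝ) : ℂ)) atTop (𝓝[≠] 1) := by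
    refine tendsto_nhdsWithin_iff.2 ⟨?_, .of_forall fun n => ?_⟩
    · have := (tendsto_one_div_add_atTop_nhds_zero_nat (𝕜 := ℝ)).const_add 1
      simpa [Function.comp_def] using (continuous_ofReal.tendsto _).comp this
    · have : (0 : ℝ) < 1 / ((n : ℝ) + 1) := by positivity
      simp only [mem_compl_iff, mem_singleton_iff, ofReal_eq_one]
      linarith
  exact htend.frequently (.of_forall fun n => hreal _ (by positivity))

/-- Along a vertical line, `Γ(v) A ^ (-v)` is bounded. -/
lemma norm_Gamma_mul_cpow_neg_le {v A : ℂ} (hv : 0 < v.re) (hA : 0 < A.re) :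
    ‖Gamma v * A ^ (-v)‖ ≤ ∫ t : ℝ in Ioi 0, t ^ (v.re - 1) * Real.exp (-(A.re * t)) := by
  rw [← integral_cpow_mul_cexp_neg_mul hv hA]
  refine (norm_integral_le_integral_norm _).trans_eq ?_
  refine setIntegral_congr_fun measurableSet_Ioi fun t ht => ?_
  simpa using norm_cpow_mul_cexp_neg_mul (v := v - 1) (A := A) ht

lemma norm_cpow_neg_vertical {w : ℂ} (hw : w ≠ 0) (γ t : ℝ) :
    ‖w ^ (-((γ : ℂ) + t * I))‖ = ‖w‖ ^ (-γ) * Real.exp (arg w * t) := by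
  rw [norm_cpow_of_ne_zero hw]
  simp [Real.exp_neg]

lemma continuous_Gamma_vertical {γ : ℝ} (hγ : 0 < γ) :
    Continuous fun t : ℝ => Gamma ((γ : ℂ) + t * I) := by
  refine continuous_iff_continuousAt.2 fun t => ?_
  refine ContinuousAt.comp (f := fun t : ℝ => (γ : ℂ) + t * I) (g := Gamma)
    (differentiableAt_Gamma _ fun m h => ?_).continuousAt (by fun_prop)
  have := congrArg re h
  simp at this
  linarith [(Nat.cast_nonneg m : (0 : ℝ) ≤ m)]

lemma integrable_exp_neg_mul_abs {δ : ℝ} (hδ : 0 < δ) :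
    Integrable fun t : ℝ => Real.exp (-(δ * |t|)) := by
  rw [← integrableOn_univ, ← Iic_union_Ioi (a := (0 : ℝ))]
  refine IntegrableOn.union ?_ ?_
  · refine (integrableOn_exp_mul_Iic hδ 0).congr_fun (fun t ht => ?_) measurableSet_Iic
    simp [abs_of_nonpos (mem_Iic.1 ht)]
  · refine (integrableOn_exp_mul_Ioi (neg_lt_zero.2 hδ) 0).congr_fun (fun t ht => ?_)
      measurableSet_Ioi
    simp [abs_of_pos (mem_Ioi.1 ht)]

/-- The exponential decay of `Γ(γ + i t)`, at any rate below `π / 2`. -/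
lemma exists_norm_Gamma_vertical_le {γ θ : ℝ} (hγ : 0 < γ) (hθ0 : 0 ≤ θ) (hθ : θ < Real.pi / 2) :
    ∃ C : ℝ, ∀ t : ℝ, ‖Gamma ((γ : ℂ) + t * I)‖ ≤ C * Real.exp (-(θ * |t|)) := by
  refine ⟨∫ t : ℝ in Ioi 0, t ^ (γ - 1) * Real.exp (-(Real.cos θ * t)), fun t => ?_⟩
  -- Rotating `A` to `e^{iφ}` makes `|A^{-v}| = e^{φt}`, while the Euler bound only sees `Re A = cos
  -- θ`. Giving `φ` the sign of `t` yields the decay.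
  have key : ∀ φ : ℝ, |φ| = θ → ‖Gamma ((γ : ℂ) + t * I)‖ * Real.exp (φ * t) ≤
      ∫ t : ℝ in Ioi 0, t ^ (γ - 1) * Real.exp (-(Real.cos θ * t)) := by
    intro φ hφ
    have hφ' := abs_le.1 hφ.le
    have hcos : 0 < Real.cos φ := Real.cos_pos_of_mem_Ioo ⟨by linarith, by linarith⟩
    have hre : (cexp (φ * I)).re = Real.cos φ := exp_ofReal_mul_I_re φ
    have harg : arg (cexp (φ * I)) = φ := by
      rw [arg_exp_mul_I, toIocMod_eq_self]
      constructor <;> linarith [Real.pi_pos]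
    have := norm_Gamma_mul_cpow_neg_le (v := γ + t * I) (A := cexp (φ * I)) (by simpa) (by rwa [hre])
    rw [norm_mul, norm_cpow_neg_vertical (exp_ne_zero _), harg, hre, norm_exp_ofReal_mul_I] at this
    simpa [← hφ] using this
  have h : ‖Gamma ((γ : ℂ) + t * I)‖ * Real.exp (θ * |t|) ≤
      ∫ t : ℝ in Ioi 0, t ^ (γ - 1) * Real.exp (-(Real.cos θ * t)) := by
    rcases le_total 0 t with ht | ht
    · simpa [abs_of_nonneg ht] using key θ (abs_of_nonneg hθ0)
    · simpa [abs_of_nonpos ht] using key (-θ) (by rw [abs_neg, abs_of_nonneg hθ0])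
  rw [Real.exp_neg, ← div_eq_mul_inv]
  exact (le_div_iff₀ (Real.exp_pos _)).2 h

/-- The factor `w^{-v}` grows at most like `e^{|arg w| |t|}`; the decay of `Γ` at a rate `θ`
strictly between `|arg w|` and `π/2` beats it. -/
lemma integrable_Gamma_mul_cpow_neg_vertical {γ : ℝ} {w : ℂ} (hγ : 0 < γ) (hw : 0 < w.re) :
    Integrable fun t : ℝ => Gamma ((γ : ℂ) + t * I) * w ^ (-((γ : ℂ) + t * I)) := by
  have hw0 : w ≠ 0 := by rintro rfl; simp at hw
  have harg : |arg w| < Real.pi / 2 := abs_arg_lt_pi_div_two_iff.2 (Or.inl hw)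
  obtain ⟨θ, h1, h2⟩ := exists_between harg
  obtain ⟨C, hC⟩ := exists_norm_Gamma_vertical_le hγ ((abs_nonneg _).trans h1.le) h2
  have hcont : Continuous fun t : ℝ => Gamma ((γ : ℂ) + t * I) * w ^ (-((γ : ℂ) + t * I)) :=
    (continuous_Gamma_vertical hγ).mul (Continuous.const_cpow (by fun_prop) (Or.inl hw0))
  refine ((integrable_exp_neg_mul_abs (sub_pos.2 h1)).const_mul (C * ‖w‖ ^ (-γ))).mono'
    hcont.aestronglyMeasurable (.of_forall fun t => ?_)
  rw [norm_mul, norm_cpow_neg_vertical hw0]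
  have hle : Real.exp (arg w * t) ≤ Real.exp (|arg w| * |t|) :=
    Real.exp_le_exp.2 ((le_abs_self _).trans_eq (abs_mul _ _))
  calc _ ≤ C * Real.exp (-(θ * |t|)) * (‖w‖ ^ (-γ) * Real.exp (|arg w| * |t|)) :=
        mul_le_mul (hC t) (by gcongr) (by positivity) ((norm_nonneg _).trans (hC t))
    _ = C * ‖w‖ ^ (-γ) * (Real.exp (-(θ * |t|)) * Real.exp (|arg w| * |t|)) := by ring
    _ = _ := by rw [← Real.exp_add]; ring_nf

/-- The Cahen-Mellin integral. -/
lemma integral_Gamma_mul_cpow_neg_vertical {γ x : ℝ} {w : ℂ} (hγ : 0 < γ) (hw : 0 < w.re)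
    (hx : 0 < x) :
    ∫ t : ℝ, (x : ℂ) ^ (-((γ : ℂ) + t * I)) *
      (Gamma ((γ : ℂ) + t * I) * w ^ (-((γ : ℂ) + t * I))) = 2 * Real.pi * cexp (-(w * x)) := by
  -- Euler's integral read as a Mellin transform, so that Mellin inversion gives the claim.
  have hmel : ∀ v : ℂ, 0 < v.re → mellin (fun t : ℝ => cexp (-(w * t))) v = Gamma v * w ^ (-v) :=
    fun v hv => integral_cpow_mul_cexp_neg_mul hv hw
  have hline : ∀ t : ℝ, 0 < ((γ : ℂ) + t * I).re := fun t => by simpa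
  have h := mellinInv_mellin_eq γ (fun t : ℝ => cexp (-(w * t))) hx
    (integrableOn_cpow_mul_cexp_neg_mul (by simpa using hγ) hw)
    ((integrable_Gamma_mul_cpow_neg_vertical hγ hw).congr
      (.of_forall fun t => (hmel _ (hline t)).symm)) (by fun_prop)
  simp only [mellinInv, smul_eq_mul, hmel _ (hline _)] at h
  rw [← h, real_smul, ← mul_assoc]
  push_cast
  rw [mul_one_div_cancel (by simp [Real.pi_ne_zero]), one_mul]

end GammaIntegrals

/-! ### Mellin-Barnes representation of the stretched Laplace transform. -/

section StretchedLaplace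

open Set Complex

/-- The Laplace transform at `A` of the stretched exponential `t ↦ exp (-w t ^ β)`. -/
noncomputable def stretchedLaplace (β : ℝ) (A w : ℂ) : ℂ :=
  ∫ t : ℝ in Ioi 0, cexp (-(A * t)) * cexp (-(w * (t ^ β : ℝ)))

/-- Justifies Fubini: since `|t^{-βv}| = t^{-βγ}` on the line, the norm is a product of a function
of `t` and a function of `τ`. The first is integrable at `0` because `βγ < 1`. -/
lemma integrable_prod_mellinBarnes {β γ : ℝ} {A w : ℂ} (hγ : 0 < γ) (hβγ : β * γ < 1)
    (hA : 0 < A.re) (hw : 0 < w.re) :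
    Integrable (Function.uncurry fun t τ : ℝ =>
      (t : ℂ) ^ (-(β * ((γ : ℂ) + τ * I))) * cexp (-(A * t)) *
        (Gamma ((γ : ℂ) + τ * I) * w ^ (-((γ : ℂ) + τ * I))))
      ((volume.restrict (Ioi 0)).prod volume) := by
  have hw0 : w ≠ 0 := by rintro rfl; simp at hw
  have hG : Continuous fun t : ℝ => Gamma ((γ : ℂ) + t * I) * w ^ (-((γ : ℂ) + t * I)) :=
    (continuous_Gamma_vertical hγ).mul (Continuous.const_cpow (by fun_prop) (Or.inl hw0))
  refine Integrable.mono' ((integrableOn_rpow_mul_exp_neg_mul (s := -(β * γ)) (by linarith)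
    hA).mul_prod (integrable_Gamma_mul_cpow_neg_vertical hγ hw).norm)
    (Measurable.aestronglyMeasurable ?_) ?_
  · refine Measurable.mul (Measurable.mul ?_ (by fun_prop)) (hG.measurable.comp measurable_snd)
    exact Measurable.pow (by fun_prop) (by fun_prop)
  · have hpos : ∀ᵐ p : ℝ × ℝ ∂((volume.restrict (Ioi 0)).prod volume), 0 < p.1 :=
      Measure.quasiMeasurePreserving_fst.ae (ae_restrict_mem measurableSet_Ioi)
    filter_upwards [hpos] with p hp
    rw [Function.uncurry, norm_mul, norm_cpow_mul_cexp_neg_mul hp]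
    simp

/-- The Mellin-Barnes representation of the Laplace transform of a stretched exponential. -/
lemma integral_mellinBarnes {β γ : ℝ} {A w : ℂ} (hγ : 0 < γ) (hβγ : β * γ < 1)
    (hA : 0 < A.re) (hw : 0 < w.re) :
    ∫ τ : ℝ, Gamma ((γ : ℂ) + τ * I) * Gamma (1 - β * ((γ : ℂ) + τ * I)) *
      (w ^ (-((γ : ℂ) + τ * I)) * A ^ (β * ((γ : ℂ) + τ * I))) =
    2 * Real.pi * (A * stretchedLaplace β A w) := by
  have hA0 : A ≠ 0 := by rintro rfl; simp at hA
  -- Integrating in `τ` first gives Cahen-Mellin at `x = t^β`; integrating in `t` first gives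
  -- Euler's integral with exponent `1 - βv`.
  have hswap := integral_integral_swap (integrable_prod_mellinBarnes (β := β) hγ hβγ hA hw)
  have hleft : ∫ t : ℝ in Ioi 0, ∫ τ : ℝ, (t : ℂ) ^ (-(β * ((γ : ℂ) + τ * I))) * cexp (-(A * t)) *
      (Gamma ((γ : ℂ) + τ * I) * w ^ (-((γ : ℂ) + τ * I))) =
      2 * Real.pi * stretchedLaplace β A w := by
    rw [stretchedLaplace, ← integral_const_mul]
    refine setIntegral_congr_fun measurableSet_Ioi fun t ht => ?_
    have ht' : 0 < t := ht
    have h := integral_Gamma_mul_cpow_neg_vertical hγ hw (Real.rpow_pos_of_pos ht' β)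
    rw [mul_left_comm, ← h, ← integral_const_mul]
    refine integral_congr_ae (.of_forall fun τ => ?_)
    simp only
    rw [← mul_neg, cpow_mul_ofReal_nonneg ht'.le]
    ring
  have hright : ∫ τ : ℝ, ∫ t : ℝ in Ioi 0, (t : ℂ) ^ (-(β * ((γ : ℂ) + τ * I))) *
      cexp (-(A * t)) * (Gamma ((γ : ℂ) + τ * I) * w ^ (-((γ : ℂ) + τ * I))) =
      A⁻¹ * ∫ τ : ℝ, Gamma ((γ : ℂ) + τ * I) * Gamma (1 - β * ((γ : ℂ) + τ * I)) *
      (w ^ (-((γ : ℂ) + τ * I)) * A ^ (β * ((γ : ℂ) + τ * I))) := by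
    rw [← integral_const_mul]
    refine integral_congr_ae (.of_forall fun τ => ?_)
    simp only
    have h := integral_cpow_mul_cexp_neg_mul (v := 1 - β * ((γ : ℂ) + τ * I)) (A := A)
      (by simpa using hβγ) hA
    rw [sub_sub_cancel_left] at h
    rw [integral_mul_const, h, neg_sub, cpow_sub _ _ hA0, cpow_one]
    ring
  have h := hright.symm.trans (hswap.symm.trans hleft)
  rw [inv_mul_eq_iff_eq_mul₀ hA0] at h
  rw [h]
  ring

/-- For `z = w A ^ (-β)` with `w` and `A ^ β` in the right half-plane, principal powers of `z`
split as expected. -/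
lemma mul_cpow_neg_cpow {β : ℝ} {A w : ℂ} (hβ : 0 ≤ β) (hA : A ≠ 0) (hw : 0 < w.re)
    (harg : β * |arg A| < Real.pi / 2) (v : ℂ) :
    (w * A ^ ((-β : ℝ) : ℂ)) ^ (-v) = w ^ (-v) * A ^ (β * v) := by
  have hw0 : w ≠ 0 := by rintro rfl; simp at hw
  have hargw : |arg w| < Real.pi / 2 := abs_arg_lt_pi_div_two_iff.2 (Or.inl hw)
  have harg' : |β * arg A| < Real.pi / 2 := by rwa [abs_mul, abs_of_nonneg hβ]
  have him : (log w - β * log A).im = arg w - β * arg A := by simp [log_im]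
  rw [abs_lt] at hargw harg'
  have hz : w * A ^ ((-β : ℝ) : ℂ) = cexp (log w - β * log A) := by
    rw [cpow_def_of_ne_zero hA, exp_sub, exp_log hw0, div_eq_mul_inv, ← exp_neg]
    congr 2
    push_cast; ring
  -- Both arguments are below `π/2` in absolute value, so their difference lies in `(-π, π)` and
  -- `log w - β log A` is the principal logarithm.
  rw [hz, cpow_def_of_ne_zero (exp_ne_zero _), log_exp (by rw [him]; linarith)
    (by rw [him]; linarith), cpow_def_of_ne_zero hw0, cpow_def_of_ne_zero hA, ← exp_add]
  congr 1
  ring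

/-- Up to the factor `A`, this is the Euler integral at `1 - βv`, whose real part is the positive
constant `1 - βγ`; the bound is therefore independent of `t`. -/
lemma norm_Gamma_mul_cpow_le_of_mem_strip {β γ : ℝ} {A : ℂ} (hβγ : β * γ < 1) (hA : 0 < A.re)
    (t : ℝ) :
    ‖Gamma (1 - β * ((γ : ℂ) + t * I)) * A ^ (β * ((γ : ℂ) + t * I))‖ ≤
      ‖A‖ * ∫ t : ℝ in Ioi 0, t ^ (-(β * γ)) * Real.exp (-(A.re * t)) := by
  have hA0 : A ≠ 0 := by rintro rfl; simp at hA
  have h := norm_Gamma_mul_cpow_neg_le (v := 1 - β * ((γ : ℂ) + t * I)) (A := A)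
    (by simpa using hβγ) hA
  have hre : (1 - β * ((γ : ℂ) + t * I)).re - 1 = -(β * γ) := by simp
  have hpow : A ^ (β * ((γ : ℂ) + t * I)) = A * A ^ (-(1 - β * ((γ : ℂ) + t * I))) := by
    rw [neg_sub, cpow_sub _ _ hA0, cpow_one, mul_div_cancel₀ _ hA0]
  rw [hre] at h
  rw [hpow, mul_left_comm, norm_mul]
  gcongr

lemma integrable_mellinBarnes {β γ : ℝ} {A w : ℂ} (hγ : 0 < γ) (hβγ : β * γ < 1)
    (hA : 0 < A.re) (hw : 0 < w.re) :
    Integrable fun τ : ℝ => Gamma ((γ : ℂ) + τ * I) * Gamma (1 - β * ((γ : ℂ) + τ * I)) *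
      (w ^ (-((γ : ℂ) + τ * I)) * A ^ (β * ((γ : ℂ) + τ * I))) := by
  have hA0 : A ≠ 0 := by rintro rfl; simp at hA
  have hcont : Continuous fun τ : ℝ =>
      Gamma (1 - β * ((γ : ℂ) + τ * I)) * A ^ (β * ((γ : ℂ) + τ * I)) := by
    refine Continuous.mul ?_ (Continuous.const_cpow (by fun_prop) (Or.inl hA0))
    have h := (continuous_Gamma_vertical (sub_pos.2 hβγ)).comp
      (by fun_prop : Continuous fun τ : ℝ => -(β * τ))
    refine h.congr fun τ => ?_
    simp only [Function.comp_apply]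
    congr 1
    push_cast; ring
  refine ((integrable_Gamma_mul_cpow_neg_vertical hγ hw).mul_bdd
    hcont.aestronglyMeasurable
    (.of_forall fun τ => norm_Gamma_mul_cpow_le_of_mem_strip hβγ hA τ)).congr
    (.of_forall fun τ => ?_)
  simp only
  ring

end StretchedLaplace

/-! ### The H-function with one upper and one lower parameter. -/

section FoxH

open Complex

/-- On each side only the pole with `ν = 0` binds: `0` on the left and `1/β` on the right. -/
lemma foxSeparates_one_one_iff {β γ : ℝ} (hβ : 0 < β) :
    FoxSeparates 1 1 ![((0 : ℂ), β)] ![((0 : ℂ), (1 : ℝ))] γ ↔ 0 < γ ∧ β * γ < 1 := by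
  have h1 : ∀ ν : ℕ, ((1 + (ν : ℂ)) / (β : ℂ)).re = (1 + ν) / β := fun ν => by
    rw [div_ofReal_re]; simp
  simp only [FoxSeparates, Fin.forall_fin_one, Fin.val_zero, Nat.lt_one_iff, true_imp_iff,
    Matrix.cons_val_zero, sub_zero, h1, zero_add, ofReal_one, div_one, neg_re, natCast_re]
  refine and_congr ⟨fun h => by simpa using h 0, fun h ν => ?_⟩ ⟨fun h => ?_, fun h ν => ?_⟩
  · linarith [(Nat.cast_nonneg ν : (0 : ℝ) ≤ ν)]
  · have := h 0
    rw [lt_div_iff₀ hβ] at this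
    simpa [mul_comm] using this
  · rw [lt_div_iff₀ hβ, mul_comm]
    linarith [(Nat.cast_nonneg ν : (0 : ℝ) ≤ ν)]

lemma foxIntegrand_one_one (β γ t : ℝ) (z : ℂ) :
    foxIntegrand 1 1 ![((0 : ℂ), β)] ![((0 : ℂ), (1 : ℝ))] z γ t =
      Gamma ((γ : ℂ) + t * I) * Gamma (1 - β * ((γ : ℂ) + t * I)) *
        z ^ (-((γ : ℂ) + t * I)) * I := by
  simp [foxIntegrand, foxKernel]

/-- The function `H^{1,1}_{1,1}` at `w A ^ (-β)` is `A` times the Laplace transform of a stretched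
exponential. -/
theorem hasFoxH_stretchedLaplace {β : ℝ} {A w : ℂ} (hβ : 0 < β) (hA : 0 < A.re) (hw : 0 < w.re)
    (harg : β * |arg A| < Real.pi / 2) :
    HasFoxH 1 1 ![((0 : ℂ), β)] ![((0 : ℂ), (1 : ℝ))] (w * A ^ ((-β : ℝ) : ℂ))
      (A * stretchedLaplace β A w) := by
  have hA0 : A ≠ 0 := by rintro rfl; simp at hA
  have hw0 : w ≠ 0 := by rintro rfl; simp at hw
  have hint : ∀ γ t : ℝ, foxIntegrand 1 1 ![((0 : ℂ), β)] ![((0 : ℂ), (1 : ℝ))]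
      (w * A ^ ((-β : ℝ) : ℂ)) γ t = Gamma ((γ : ℂ) + t * I) * Gamma (1 - β * ((γ : ℂ) + t * I)) *
      (w ^ (-((γ : ℂ) + t * I)) * A ^ (β * ((γ : ℂ) + t * I))) * I := fun γ t => by
    rw [foxIntegrand_one_one, mul_cpow_neg_cpow hβ.le hA0 hw harg]
  refine ⟨⟨le_rfl, le_rfl⟩, ⟨?_, ?_⟩, ?_, ?_, fun γ hγ => ?_, fun γ hγ => ?_⟩
  · simpa using hβ
  · simp
  · exact mul_ne_zero hw0 (by simp [cpow_eq_zero_iff, hA0])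
  -- The midpoint of the strip `0 < γ < 1/β`.
  · refine ⟨(2 * β)⁻¹, (foxSeparates_one_one_iff hβ).2 ⟨by positivity, ?_⟩⟩
    field_simp
    norm_num
  · obtain ⟨h0, h1⟩ := (foxSeparates_one_one_iff hβ).1 hγ
    simp only [funext (hint γ)]
    exact (integrable_mellinBarnes h0 h1 hA hw).mul_const I
  · obtain ⟨h0, h1⟩ := (foxSeparates_one_one_iff hβ).1 hγ
    simp only [hint γ]
    rw [integral_mul_const, integral_mellinBarnes h0 h1 hA hw]
    field_simp

lemma HasFoxH.foxH_eq {m n p q : ℕ} {a : Fin p → ℂ × ℝ} {b : Fin q → ℂ × ℝ} {z h : ℂ}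
    (H : HasFoxH m n a b z h) : foxH m n a b z = h := by
  have hex : ∃ w, HasFoxH m n a b z w := ⟨h, H⟩
  rw [foxH, dif_pos hex]
  exact hex.choose_spec.unique H

end FoxH

/-! ### Small-noise estimate for the stretched Laplace transform. -/

section StretchedLaplaceBounds

open Set Complex

lemma integral_cexp_neg_mul_Ioi {A : ℂ} (hA : 0 < A.re) :
    ∫ t : ℝ in Ioi 0, cexp (-(A * t)) = A⁻¹ := by
  have := integral_exp_mul_complex_Ioi (a := -A) (by simpa) 0
  simpa [neg_mul] using this

/-- Mean value inequality on the convex half-plane `Re ≤ 0`, where the derivative of `exp` has norm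
at most `1`. -/
lemma norm_cexp_sub_one_le_of_re_nonpos {z : ℂ} (hz : z.re ≤ 0) : ‖cexp z - 1‖ ≤ ‖z‖ := by
  have := (convex_halfSpace_re_le (0 : ℝ)).norm_image_sub_le_of_norm_deriv_le (𝕜 := ℂ) (f := cexp)
    (C := 1) (x := 0) (y := z) (fun x _ => differentiableAt_exp)
    (fun x hx => by simpa [norm_exp] using hx) (by simp) hz
  simpa using this

lemma re_neg_mul_rpow_nonpos {w : ℂ} (hw : 0 ≤ w.re) (β : ℝ) {t : ℝ} (ht : 0 ≤ t) :
    (-(w * (t ^ β : ℝ))).re ≤ 0 := by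
  rw [neg_re, re_mul_ofReal]
  exact neg_nonpos.2 (mul_nonneg hw (Real.rpow_nonneg ht _))

lemma integrableOn_cexp_neg_mul {A : ℂ} (hA : 0 < A.re) :
    IntegrableOn (fun t : ℝ => cexp (-(A * t))) (Ioi 0) := by
  simpa using integrableOn_cpow_mul_cexp_neg_mul (v := 0) (by simp) hA

lemma integrableOn_stretchedLaplace {A w : ℂ} (hA : 0 < A.re) (hw : 0 ≤ w.re) (β : ℝ) :
    IntegrableOn (fun t : ℝ => cexp (-(A * t)) * cexp (-(w * (t ^ β : ℝ)))) (Ioi 0) := by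
  refine (integrableOn_cexp_neg_mul hA).mul_bdd (c := 1)
    (Measurable.aestronglyMeasurable (by fun_prop)) ?_
  refine (ae_restrict_iff' measurableSet_Ioi).2 (.of_forall fun t ht => ?_)
  rw [norm_exp]
  exact Real.exp_le_one_iff.2 (re_neg_mul_rpow_nonpos hw β (le_of_lt ht))

/-- Distance of the Laplace transform of a stretched exponential from its value at `w = 0`. -/
lemma norm_stretchedLaplace_sub_inv_le {β a : ℝ} {A w : ℂ} (hβ : 0 ≤ β) (ha : 0 < a)
    (haA : a ≤ A.re) (hw : 0 ≤ w.re) :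
    ‖stretchedLaplace β A w - A⁻¹‖ ≤ ‖w‖ * ∫ t : ℝ in Ioi 0, t ^ β * Real.exp (-(a * t)) := by
  have hA : 0 < A.re := ha.trans_le haA
  rw [stretchedLaplace, ← integral_cexp_neg_mul_Ioi hA,
    ← integral_sub (integrableOn_stretchedLaplace hA hw β) (integrableOn_cexp_neg_mul hA),
    ← integral_const_mul]
  refine norm_integral_le_of_norm_le
    ((integrableOn_rpow_mul_exp_neg_mul (by linarith) ha).const_mul _) ?_
  refine (ae_restrict_iff' measurableSet_Ioi).2 (.of_forall fun t ht => ?_)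
  have ht' : 0 < t := ht
  have h1 := norm_cexp_sub_one_le_of_re_nonpos (re_neg_mul_rpow_nonpos hw β ht'.le)
  rw [norm_neg, norm_mul, Complex.norm_of_nonneg (Real.rpow_nonneg ht'.le _)] at h1
  rw [← mul_sub_one, norm_mul, norm_exp]
  have h2 : (-(A * t)).re ≤ -(a * t) := by
    rw [neg_re, re_mul_ofReal]
    exact neg_le_neg (by gcongr)
  calc _ ≤ Real.exp (-(a * t)) * (‖w‖ * t ^ β) := by gcongr
    _ = _ := by ring

end StretchedLaplaceBounds

/-! ### Laws of the distance and of the far-user distance. -/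

section FarDistance

open Set

/-- The fundamental theorem of calculus for a density `p` cut off at `0`: `q` is its smooth
expression, continuous on all of `ℝ`, and `G` is an antiderivative of `q`. It serves for both `F_d`
and `F_d²`. -/
lemma withDensity_Iic_of_hasDerivAt {p q G : ℝ → ℝ} (h0 : ∀ x ≤ 0, p x = 0)
    (hpq : ∀ x, 0 < x → p x = q x) (hpos : ∀ x, 0 < x → 0 ≤ q x) (hq : Continuous q)
    (hG : ∀ x, HasDerivAt G (q x) x) (hG0 : G 0 = 0) {x : ℝ} (hx : 0 ≤ x) :
    volume.withDensity (fun x => ENNReal.ofReal (p x)) (Iic x) = ENNReal.ofReal (G x) := by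
  have hneg : ∫⁻ y in Iic 0, ENNReal.ofReal (p y) = 0 := by
    rw [setLIntegral_congr_fun measurableSet_Iic (g := fun _ => 0) fun y hy => by
      simp [h0 y hy]]
    simp
  have hnn : 0 ≤ᵐ[volume.restrict (Ioc 0 x)] q :=
    (ae_restrict_iff' measurableSet_Ioc).2 (.of_forall fun y hy => hpos y hy.1)
  rw [withDensity_apply _ measurableSet_Iic, ← Iic_union_Ioc_eq_Iic hx,
    lintegral_union measurableSet_Ioc (Iic_disjoint_Ioc le_rfl), hneg, zero_add,
    setLIntegral_congr_fun measurableSet_Ioc (g := fun y => ENNReal.ofReal (q y)) fun y hy => by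
      simp only [hpq y hy.1],
    ← ofReal_integral_eq_lintegral_ofReal (hq.integrableOn_Ioc) hnn,
    ← intervalIntegral.integral_of_le hx,
    intervalIntegral.integral_eq_sub_of_hasDerivAt (fun y _ => hG y) (hq.intervalIntegrable _ _),
    hG0, sub_zero]

lemma withDensity_Iic_eq_zero {p : ℝ → ℝ} (h0 : ∀ x ≤ 0, p x = 0) {x : ℝ} (hx : x ≤ 0) :
    volume.withDensity (fun x => ENNReal.ofReal (p x)) (Iic x) = 0 := by
  rw [withDensity_apply _ measurableSet_Iic,
    setLIntegral_congr_fun measurableSet_Iic (g := fun _ => 0) fun y hy => by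
      simp [h0 y (le_trans hy hx)]]
  simp

lemma distancePDF_of_nonpos {c lam x : ℝ} (hx : x ≤ 0) : distancePDF c lam x = 0 := by
  rcases hx.eq_or_lt with rfl | hx
  · simp [distancePDF]
  · simp [distancePDF, not_le.2 hx]

lemma distancePDF_of_pos {c lam x : ℝ} (hx : 0 < x) :
    distancePDF c lam x =
      2 * c * lam * Real.pi * x * Real.exp (-(c * lam * Real.pi * x ^ 2)) :=
  if_pos hx.le

lemma hasDerivAt_one_sub_exp_neg_mul_sq (a x : ℝ) :
    HasDerivAt (fun x => 1 - Real.exp (-(a * x ^ 2))) (2 * a * x * Real.exp (-(a * x ^ 2))) x := by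
  have h : HasDerivAt (fun x : ℝ => -(a * x ^ 2)) (-(a * (2 * x))) x := by
    simpa using ((hasDerivAt_pow 2 x).const_mul a).fun_neg
  convert! (h.exp.const_sub 1) using 1
  ring

lemma distanceLaw_Iic {c lam x : ℝ} (hc : 0 < c) (hlam : 0 < lam) (hx : 0 ≤ x) :
    distanceLaw c lam (Iic x) =
      ENNReal.ofReal (1 - Real.exp (-(c * lam * Real.pi * x ^ 2))) := by
  have hpi := Real.pi_pos
  refine withDensity_Iic_of_hasDerivAt
    (q := fun x => 2 * (c * lam * Real.pi) * x * Real.exp (-(c * lam * Real.pi * x ^ 2)))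
    (G := fun x => 1 - Real.exp (-(c * lam * Real.pi * x ^ 2)))
    (fun x hx => distancePDF_of_nonpos hx) (fun x hx => ?_) (fun x hx => by positivity)
    (by fun_prop) (hasDerivAt_one_sub_exp_neg_mul_sq _) (by simp) hx
  rw [distancePDF_of_pos hx]
  ring

lemma distanceCDF_eq {c lam x : ℝ} [IsProbabilityMeasure (distanceLaw c lam)] (hc : 0 < c)
    (hlam : 0 < lam) (hx : 0 ≤ x) :
    distanceCDF c lam x = 1 - Real.exp (-(c * lam * Real.pi * x ^ 2)) := by
  rw [distanceCDF, cdf_eq_real, measureReal_def, distanceLaw_Iic hc hlam hx, ENNReal.toReal_ofReal]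
  have hpi := Real.pi_pos
  exact sub_nonneg.2 (Real.exp_le_one_iff.2 (neg_nonpos.2 (by positivity)))

/-- The distribution function of the far-user distance is the square of that of a distance. -/
lemma map_farDistance_Iic {Ω : Type*} [MeasurableSpace Ω] {μ : Measure Ω} [IsProbabilityMeasure μ]
    {K : ℕ} {P : Measure ℝ} {D : Fin (2 * K) → Ω → ℝ} (hD : ∀ i, HasLaw (D i) P μ)
    (hDind : iIndepFun D μ) {G : Ω → Grouping K} (hG : AEMeasurable G μ)
    (hGD : IndepFun G (fun w i => D i w) μ) (k : Fin K) :
    AEMeasurable (farDistance G D k) μ ∧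
      ∀ x, μ.map (farDistance G D k) (Iic x) = P (Iic x) ^ 2 := by
  have hDm : AEMeasurable (fun w i => D i w) μ := aemeasurable_pi_lambda _ fun i =>
    (hD i).aemeasurable
  let far : Grouping K × (Fin (2 * K) → ℝ) → ℝ :=
    fun p => max (p.2 (p.1 (k, false))) (p.2 (p.1 (k, true)))
  have hfar : Measurable far := by
    -- There are finitely many groupings and all sets of them are measurable, so it suffices to fix
    -- one.
    refine measurable_from_prod_countable_right fun g => ?_
    exact Measurable.max (measurable_pi_apply (g (k, false))) (measurable_pi_apply (g (k, true)))
  have hpair : AEMeasurable (fun w => (G w, fun i => D i w)) μ := hG.prodMk hDm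
  have hcomp : farDistance G D k = far ∘ fun w => (G w, fun i => D i w) := rfl
  refine ⟨hcomp ▸ hfar.comp_aemeasurable hpair, fun x => ?_⟩
  have : IsProbabilityMeasure (μ.map G) := Measure.isProbabilityMeasure_map hG
  have : IsProbabilityMeasure (μ.map fun w i => D i w) := Measure.isProbabilityMeasure_map hDm
  rw [hcomp, ← AEMeasurable.map_map_of_aemeasurable hfar.aemeasurable hpair,
    Measure.map_apply hfar measurableSet_Iic,
    (indepFun_iff_map_prod_eq_prod_map_map hG hDm).1 hGD,
    Measure.prod_apply (hfar measurableSet_Iic)]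
  -- Given the grouping, the pair consists of two distinct, hence independent, users. The value is
  -- the same for every `g`, so averaging over `G` leaves it unchanged.
  have hslice : ∀ g : Grouping K,
      (μ.map fun w i => D i w) (Prod.mk g ⁻¹' (far ⁻¹' Iic x)) = P (Iic x) ^ 2 := by
    intro g
    have hne : g (k, false) ≠ g (k, true) := by simp
    have hset : (fun w i => D i w) ⁻¹' (Prod.mk g ⁻¹' (far ⁻¹' Iic x)) =
        D (g (k, false)) ⁻¹' Iic x ∩ D (g (k, true)) ⁻¹' Iic x := by
      ext w; simp [far]
    have hP : ∀ i, μ (D i ⁻¹' Iic x) = P (Iic x) := fun i => by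
      rw [← (hD i).map_eq, Measure.map_apply_of_aemeasurable (hD i).aemeasurable measurableSet_Iic]
    rw [Measure.map_apply_of_aemeasurable hDm
      (measurable_prodMk_left (hfar measurableSet_Iic)), hset,
      (hDind.indepFun hne).measure_inter_preimage_eq_mul _ _ measurableSet_Iic measurableSet_Iic,
      hP, hP, sq]
  simp [hslice]

/-- The far-user distance has density `2 F_d f_d`. -/
theorem hasLaw_farDistance {Ω : Type*} [MeasurableSpace Ω] {μ : Measure Ω} [IsProbabilityMeasure μ]
    {K : ℕ} {c lam : ℝ} (hc : 0 < c) (hlam : 0 < lam) {D : Fin (2 * K) → Ω → ℝ}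
    (hD : ∀ i, HasLaw (D i) (distanceLaw c lam) μ) (hDind : iIndepFun D μ) {G : Ω → Grouping K}
    (hG : AEMeasurable G μ) (hGD : IndepFun G (fun w i => D i w) μ) (k : Fin K)
    [IsProbabilityMeasure (distanceLaw c lam)] :
    HasLaw (farDistance G D k) (volume.withDensity fun x =>
      ENNReal.ofReal (2 * distanceCDF c lam x * distancePDF c lam x)) μ := by
  obtain ⟨hmeas, hmap⟩ := map_farDistance_Iic hD hDind hG hGD k
  have hpi := Real.pi_pos
  have hnn : ∀ x : ℝ, 0 ≤ 1 - Real.exp (-(c * lam * Real.pi * x ^ 2)) := fun x =>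
    sub_nonneg.2 (Real.exp_le_one_iff.2 (neg_nonpos.2 (by positivity)))
  have h0 : ∀ x ≤ 0, 2 * distanceCDF c lam x * distancePDF c lam x = 0 := fun x hx => by
    rw [distancePDF_of_nonpos hx, mul_zero]
  have : IsProbabilityMeasure (μ.map (farDistance G D k)) := Measure.isProbabilityMeasure_map hmeas
  refine ⟨hmeas, Measure.ext_of_Iic _ _ fun x => ?_⟩
  rw [hmap]
  rcases le_total 0 x with hx | hx
  · rw [distanceLaw_Iic hc hlam hx, ← ENNReal.ofReal_pow (hnn x)]
    -- The density `2 F_d f_d` is the derivative of `F_d²`.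
    refine (withDensity_Iic_of_hasDerivAt
      (q := fun x => 2 * (1 - Real.exp (-(c * lam * Real.pi * x ^ 2))) *
        (2 * (c * lam * Real.pi) * x * Real.exp (-(c * lam * Real.pi * x ^ 2))))
      (G := fun x => (1 - Real.exp (-(c * lam * Real.pi * x ^ 2))) ^ 2) h0 (fun x hx => ?_)
      (fun x hx => mul_nonneg (mul_nonneg zero_le_two (hnn x)) (by positivity)) (by fun_prop)
      (fun x => ?_) (by simp) hx).symm
    · rw [distanceCDF_eq hc hlam hx.le, distancePDF_of_pos hx]
      ring
    · simpa using (hasDerivAt_one_sub_exp_neg_mul_sq (c * lam * Real.pi) x).fun_pow 2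
  · rw [withDensity_Iic_eq_zero h0 hx, distanceLaw,
      withDensity_Iic_eq_zero (fun x hx => distancePDF_of_nonpos hx) hx]
    simp

end FarDistance

/-! ### Arguments and real parts of `c' + ω s^{2/α}`. -/

section Sector

open Complex

/-- In the right half-plane `arg z = arcsin (Im z / |z|)`; adding `c ≥ 0` keeps the imaginary part
and does not decrease the modulus. -/
lemma abs_arg_ofReal_add_le {c : ℝ} {x : ℂ} (hc : 0 ≤ c) (hx : 0 ≤ x.re) :
    |arg (c + x)| ≤ |arg x| := by
  rcases eq_or_ne x 0 with rfl | hx0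
  · simp [arg_ofReal_of_nonneg hc]
  have hre : 0 ≤ ((c : ℂ) + x).re := by simpa using add_nonneg hc hx
  have hnorm : ‖x‖ ≤ ‖(c : ℂ) + x‖ := by
    rw [norm_def, norm_def]
    refine Real.sqrt_le_sqrt ?_
    simp only [normSq_apply, add_re, add_im, ofReal_re, ofReal_im, zero_add]
    nlinarith
  have hxpos : 0 < ‖x‖ := norm_pos_iff.2 hx0
  have habs : ∀ y : ℝ, |Real.arcsin y| = Real.arcsin |y| := fun y => by
    rcases le_total 0 y with hy | hy
    · rw [abs_of_nonneg hy, abs_of_nonneg (Real.arcsin_nonneg.2 hy)]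
    · rw [abs_of_nonpos hy, abs_of_nonpos (Real.arcsin_nonpos.2 hy), Real.arcsin_neg]
  rw [arg_of_re_nonneg hre, arg_of_re_nonneg hx, habs, habs]
  refine Real.monotone_arcsin ?_
  rw [abs_div, abs_div, abs_norm, abs_norm, add_im, ofReal_im, zero_add]
  gcongr

lemma arg_cpow_ofReal {s : ℂ} {δ : ℝ} (hs : s ≠ 0) (h : |δ * arg s| < Real.pi) :
    arg (s ^ (δ : ℂ)) = δ * arg s := by
  obtain ⟨h1, h2⟩ := abs_lt.1 h
  have him : (log s * (δ : ℂ)).im = δ * arg s := by simp [log_im, mul_comm]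
  rw [cpow_def_of_ne_zero hs, ← log_im, log_exp (by rwa [him]) (by rw [him]; exact h2.le), him]

variable {α lam c' ω : ℝ} {s : ℂ}

lemma abs_mul_arg_lt (hα : 2 < α) (hs : 0 < s.re) : |2 / α * arg s| < Real.pi / 2 := by
  have harg : |arg s| < Real.pi / 2 := abs_arg_lt_pi_div_two_iff.2 (Or.inl hs)
  have h1 : 2 / α < 1 := (div_lt_one (by linarith)).2 hα
  rw [abs_mul, abs_of_pos (by positivity : 0 < 2 / α)]
  nlinarith [abs_nonneg (arg s)]

lemma cpow_two_div_re_nonneg (hα : 2 < α) (hs : 0 < s.re) : 0 ≤ (s ^ ((2 / α : ℝ) : ℂ)).re := by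
  have hs0 : s ≠ 0 := by rintro rfl; simp at hs
  have h := abs_mul_arg_lt hα hs
  refine abs_arg_le_pi_div_two_iff.1 ?_
  rw [arg_cpow_ofReal hs0 (h.trans (by linarith [Real.pi_pos]))]
  exact h.le

lemma le_re_add_mul_cpow (hα : 2 < α) (hω : 0 ≤ ω) (hs : 0 < s.re) :
    c' ≤ ((c' : ℂ) + ω * s ^ ((2 / α : ℝ) : ℂ)).re := by
  rw [add_re, ofReal_re, re_ofReal_mul]
  linarith [mul_nonneg hω (cpow_two_div_re_nonneg hα hs)]

/-- The exponents `α/2` and `2/α` cancel, leaving at most `|arg s| < π/2`. This is the branch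
condition needed by `hasFoxH_stretchedLaplace`. -/
lemma mul_abs_arg_lt_pi_div_two (hα : 2 < α) (hlam : 0 < lam) (hc : 0 < c') (hω : 0 ≤ ω)
    (hs : 0 < s.re) :
    α / 2 * |arg ((Real.pi * lam : ℝ) * ((c' : ℂ) + ω * s ^ ((2 / α : ℝ) : ℂ)))| <
      Real.pi / 2 := by
  have hs0 : s ≠ 0 := by rintro rfl; simp at hs
  have hre := cpow_two_div_re_nonneg hα hs
  have hα0 : 0 < α := by linarith
  rw [arg_real_mul _ (mul_pos Real.pi_pos hlam)]
  have hle : |arg ((c' : ℂ) + ω * s ^ ((2 / α : ℝ) : ℂ))| ≤ 2 / α * |arg s| := by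
    refine (abs_arg_ofReal_add_le hc.le ?_).trans ?_
    · rw [re_ofReal_mul]; exact mul_nonneg hω hre
    rcases hω.eq_or_lt with rfl | hω
    · rw [ofReal_zero, zero_mul, arg_zero, abs_zero]; positivity
    · rw [arg_real_mul _ hω,
        arg_cpow_ofReal hs0 ((abs_mul_arg_lt hα hs).trans (by linarith [Real.pi_pos])), abs_mul,
        abs_of_pos (by positivity : 0 < 2 / α)]
  calc _ ≤ α / 2 * (2 / α * |arg s|) := by gcongr
    _ = |arg s| := by field_simp
    _ < _ := abs_arg_lt_pi_div_two_iff.2 (Or.inl hs)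

end Sector

/-! ### The averaging term: integral form, H-function form, and noise estimate. -/

section AveragingTerm

open Complex Set

variable {N : ℕ} {α lam c σ P ρ : ℝ} {u : EuclideanSpace ℂ (Fin N)} {s : ℂ}

lemma interferenceCoeff_nonneg {r : ℝ} (hα : 2 < α) (hr : 0 ≤ r) :
    0 ≤ interferenceCoeff α r u := by
  have h1 : 2 / α < 1 := (div_lt_one (by linarith)).2 hα
  have := Real.Gamma_pos_of_pos (sub_pos.2 h1)
  unfold interferenceCoeff
  positivity

lemma filteredNoise_pos (hu : u ≠ 0) (hσ : 0 < σ) : 0 < filteredNoise σ u := by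
  have := norm_pos_iff.2 hu
  unfold filteredNoise
  positivity

lemma measurable_averagingIntegrand : Measurable (averagingIntegrand α lam σ P ρ u s) := by
  unfold averagingIntegrand pathLoss
  fun_prop

lemma norm_averagingIntegrand_le_one (hα : 2 < α) (hlam : 0 < lam) (hP : 0 < P) (hρ : 0 ≤ ρ)
    (hs : 0 < s.re) {d : ℝ} (hd : 0 ≤ d) : ‖averagingIntegrand α lam σ P ρ u s d‖ ≤ 1 := by
  have h1 : 0 ≤ filteredNoise σ u / (P * pathLoss α d) := by
    unfold filteredNoise pathLoss; positivity
  have h2 : 0 ≤ Real.pi * lam * interferenceCoeff α (ρ / P) u * d ^ 2 := by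
    have := interferenceCoeff_nonneg (u := u) hα (div_nonneg hρ hP.le)
    have := Real.pi_pos
    positivity
  rw [averagingIntegrand, norm_exp, Real.exp_le_one_iff, sub_re, neg_mul, neg_re, re_ofReal_mul,
    re_ofReal_mul]
  linarith [mul_nonneg h1 hs.le, mul_nonneg h2 (cpow_two_div_re_nonneg hα hs)]

/-- Exhibits the integrand as a function of `d²`, ready for the substitution `t = d²`; the path loss
enters through `d^α = (d²)^{α/2}`. -/
lemma averagingIntegrand_of_pos {d : ℝ} (hd : 0 < d) :
    averagingIntegrand α lam σ P ρ u s d =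
      cexp (-(((filteredNoise σ u / P : ℝ) : ℂ) * s * (((d ^ 2) ^ (α / 2) : ℝ) : ℂ))) *
        cexp (-(((Real.pi * lam : ℝ) : ℂ) *
          ((interferenceCoeff α (ρ / P) u : ℂ) * s ^ ((2 / α : ℝ) : ℂ)) * ((d ^ 2 : ℝ) : ℂ))) := by
  have hpow : (d ^ 2) ^ (α / 2) = d ^ α := by
    rw [← Real.rpow_natCast_mul hd.le]
    congr 1
    push_cast; ring
  have hloss : filteredNoise σ u / (P * pathLoss α d) = filteredNoise σ u / P * d ^ α := by
    rw [pathLoss, Real.rpow_neg hd.le, ← div_div, div_inv_eq_mul]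
  rw [averagingIntegrand, hpow, hloss, ← Complex.exp_add]
  congr 1
  push_cast
  ring

/-- Expectations under the far-user law, in the variable `t = d ^ 2`. -/
lemma integral_farDensity_eq {f g : ℝ → ℂ} [IsProbabilityMeasure (distanceLaw c lam)] (hc : 0 < c)
    (hlam : 0 < lam) (hfg : ∀ x, 0 < x → f x = g (x ^ 2)) :
    ∫ x, f x ∂(volume.withDensity fun x =>
      ENNReal.ofReal (2 * distanceCDF c lam x * distancePDF c lam x)) =
    ∫ t in Ioi (0 : ℝ), (2 * c * lam * Real.pi : ℂ) *
      (cexp (-((c * lam * Real.pi : ℝ) * t)) - cexp (-((2 * c * lam * Real.pi : ℝ) * t))) *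
        g t := by
  have hpi := Real.pi_pos
  have hmeasPDF : Measurable (distancePDF c lam) := by
    unfold distancePDF
    exact Measurable.ite measurableSet_Ici (by fun_prop) measurable_const
  have hmeasCDF : Measurable (distanceCDF c lam) := (monotone_cdf _).measurable
  -- The density vanishes off `(0, ∞)`, and under `t = x²` its factor `x` is absorbed by `dt = 2x
  -- dx`.
  rw [integral_withDensity_eq_integral_toReal_smul (by fun_prop) (by simp),
    ← setIntegral_eq_integral_of_forall_compl_eq_zero (s := Ioi 0) fun x hx => by
      rw [distancePDF_of_nonpos (not_lt.1 hx)]; simp,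
    ← integral_comp_rpow_Ioi_of_pos (g := fun t : ℝ => (2 * c * lam * Real.pi : ℂ) *
      (cexp (-((c * lam * Real.pi : ℝ) * t)) - cexp (-((2 * c * lam * Real.pi : ℝ) * t))) * g t)
      two_pos]
  refine setIntegral_congr_fun measurableSet_Ioi fun x hx => ?_
  have hx' : 0 < x := hx
  have hnn : 0 ≤ 1 - Real.exp (-(c * lam * Real.pi * x ^ 2)) :=
    sub_nonneg.2 (Real.exp_le_one_iff.2 (neg_nonpos.2 (by positivity)))
  have hsq : Real.exp (-(2 * c * lam * Real.pi * x ^ 2)) =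
      Real.exp (-(c * lam * Real.pi * x ^ 2)) * Real.exp (-(c * lam * Real.pi * x ^ 2)) := by
    rw [← Real.exp_add]; ring_nf
  rw [hfg x hx', distanceCDF_eq hc hlam hx'.le, distancePDF_of_pos hx', ENNReal.toReal_ofReal
    (by positivity), Real.rpow_two, real_smul, real_smul]
  norm_num only [Real.rpow_one]
  norm_cast
  rw [hsq]
  push_cast
  ring

/-- The averaging term as a difference of Laplace transforms of a stretched exponential. -/
theorem averagingTerm_eq {Ω : Type*} [MeasurableSpace Ω] {μ : Measure Ω} {d : Ω → ℝ}
    [IsProbabilityMeasure (distanceLaw c lam)]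
    (hd : HasLaw d (volume.withDensity fun x =>
      ENNReal.ofReal (2 * distanceCDF c lam x * distancePDF c lam x)) μ)
    (hα : 2 < α) (hc : 0 < c) (hlam : 0 < lam) (hP : 0 < P) (hρ : 0 ≤ ρ) (hs : 0 < s.re) :
    averagingTerm μ d α lam σ P ρ u s = (2 * c * lam * Real.pi : ℂ) *
      (stretchedLaplace (α / 2) ((Real.pi * lam : ℝ) *
          ((c : ℂ) + interferenceCoeff α (ρ / P) u * s ^ ((2 / α : ℝ) : ℂ)))
          ((filteredNoise σ u / P : ℝ) * s) -
        stretchedLaplace (α / 2) ((Real.pi * lam : ℝ) *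
          (((2 * c : ℝ) : ℂ) + interferenceCoeff α (ρ / P) u * s ^ ((2 / α : ℝ) : ℂ)))
          ((filteredNoise σ u / P : ℝ) * s)) := by
  have hω := interferenceCoeff_nonneg (u := u) hα (div_nonneg hρ hP.le)
  have hw : 0 ≤ (((filteredNoise σ u / P : ℝ) : ℂ) * s).re := by
    rw [re_ofReal_mul]
    unfold filteredNoise
    positivity
  have hA : ∀ c' : ℝ, 0 < c' → 0 < (((Real.pi * lam : ℝ) : ℂ) *
      ((c' : ℂ) + interferenceCoeff α (ρ / P) u * s ^ ((2 / α : ℝ) : ℂ))).re := fun c' hc' => by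
    rw [re_ofReal_mul]
    exact mul_pos (mul_pos Real.pi_pos hlam) (hc'.trans_le (le_re_add_mul_cpow hα hω hs))
  have hcomp := hd.integral_comp (f := averagingIntegrand α lam σ P ρ u s)
    measurable_averagingIntegrand.aestronglyMeasurable
  rw [averagingTerm, show ∫ w, averagingIntegrand α lam σ P ρ u s (d w) ∂μ =
    ∫ x, averagingIntegrand α lam σ P ρ u s x ∂_ from hcomp,
    integral_farDensity_eq
      (g := fun t : ℝ => cexp (-(((filteredNoise σ u / P : ℝ) : ℂ) * s * ((t ^ (α / 2) : ℝ) : ℂ))) *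
        cexp (-(((Real.pi * lam : ℝ) : ℂ) *
          ((interferenceCoeff α (ρ / P) u : ℂ) * s ^ ((2 / α : ℝ) : ℂ)) * (t : ℂ))))
      hc hlam fun x hx => averagingIntegrand_of_pos hx,
    stretchedLaplace, stretchedLaplace,
    ← integral_sub (integrableOn_stretchedLaplace (hA c hc) hw _)
      (integrableOn_stretchedLaplace (hA (2 * c) (by positivity)) hw _), ← integral_const_mul]
  refine setIntegral_congr_fun measurableSet_Ioi fun t _ => ?_
  have hsplit : ∀ c' : ℝ, cexp (-(((Real.pi * lam : ℝ) : ℂ) *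
      ((c' : ℂ) + interferenceCoeff α (ρ / P) u * s ^ ((2 / α : ℝ) : ℂ)) * t)) =
      cexp (-((c' * lam * Real.pi : ℝ) * t)) * cexp (-(((Real.pi * lam : ℝ) : ℂ) *
          ((interferenceCoeff α (ρ / P) u : ℂ) * s ^ ((2 / α : ℝ) : ℂ)) * (t : ℂ))) := fun c' => by
    rw [← Complex.exp_add]
    congr 1
    push_cast
    ring
  simp only [hsplit]
  ring

lemma add_mul_cpow_ne_zero {c' ω : ℝ} (hα : 2 < α) (hc : 0 < c') (hω : 0 ≤ ω) (hs : 0 < s.re) :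
    (c' : ℂ) + ω * s ^ ((2 / α : ℝ) : ℂ) ≠ 0 := fun h => by
  have := le_re_add_mul_cpow (c' := c') hα hω hs
  rw [h, zero_re] at this
  linarith

lemma hasFoxH_foxArgument {c' ω ν : ℝ} (hα : 2 < α) (hlam : 0 < lam) (hc : 0 < c') (hω : 0 ≤ ω)
    (hν : 0 < ν) (hs : 0 < s.re) :
    HasFoxH 1 1 ![(0, α / 2)] ![(0, 1)] (foxArgument α lam ν c' ω s)
      ((Real.pi * lam : ℝ) * ((c' : ℂ) + ω * s ^ ((2 / α : ℝ) : ℂ)) *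
        stretchedLaplace (α / 2)
          ((Real.pi * lam : ℝ) * ((c' : ℂ) + ω * s ^ ((2 / α : ℝ) : ℂ))) (ν * s)) := by
  refine hasFoxH_stretchedLaplace (by linarith) ?_ ?_
    (mul_abs_arg_lt_pi_div_two hα hlam hc hω hs)
  · rw [re_ofReal_mul]
    exact mul_pos (mul_pos Real.pi_pos hlam) (hc.trans_le (le_re_add_mul_cpow hα hω hs))
  · rw [re_ofReal_mul]
    exact mul_pos hν hs

/-- The averaging term through Fox's H-function. -/
theorem averagingTerm_eq_foxH {Ω : Type*} [MeasurableSpace Ω] {μ : Measure Ω} {d : Ω → ℝ}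
    [IsProbabilityMeasure (distanceLaw c lam)]
    (hd : HasLaw d (volume.withDensity fun x =>
      ENNReal.ofReal (2 * distanceCDF c lam x * distancePDF c lam x)) μ)
    (hα : 2 < α) (hc : 0 < c) (hlam : 0 < lam) (hu : u ≠ 0) (hσ : 0 < σ) (hP : 0 < P) (hρ : 0 ≤ ρ)
    (hs : 0 < s.re) :
    averagingTerm μ d α lam σ P ρ u s =
      2 * c / (c + interferenceCoeff α (ρ / P) u * s ^ ((2 / α : ℝ) : ℂ)) *
        foxH 1 1 ![(0, α / 2)] ![(0, 1)]
          (foxArgument α lam (filteredNoise σ u / P) c (interferenceCoeff α (ρ / P) u) s) -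
      2 * c / (2 * c + interferenceCoeff α (ρ / P) u * s ^ ((2 / α : ℝ) : ℂ)) *
        foxH 1 1 ![(0, α / 2)] ![(0, 1)]
          (foxArgument α lam (filteredNoise σ u / P) (2 * c)
            (interferenceCoeff α (ρ / P) u) s) := by
  have hω := interferenceCoeff_nonneg (u := u) hα (div_nonneg hρ hP.le)
  have hν := div_pos (filteredNoise_pos hu hσ) hP
  have hc2 : 0 < 2 * c := by positivity
  have h1 := add_mul_cpow_ne_zero hα hc hω hs
  have h2 := add_mul_cpow_ne_zero hα hc2 hω hs
  -- Each H-value is `A L(A)`, and the factor `πλ(c' + ω s^{2/α})` of `A` turns the prefactor `2c /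
  -- (c' + ω s^{2/α})` into the common constant `2cλπ`.
  rw [(hasFoxH_foxArgument hα hlam hc hω hν hs).foxH_eq,
    (hasFoxH_foxArgument hα hlam hc2 hω hν hs).foxH_eq, averagingTerm_eq hd hα hc hlam hP hρ hs]
  push_cast at h1 h2 ⊢
  field_simp

/-- The averaging term is close to its interference-limited value, with an error proportional to
`σ ^ 2 / P`. -/
theorem norm_averagingTerm_sub_le {Ω : Type*} [MeasurableSpace Ω] {μ : Measure Ω} {d : Ω → ℝ}
    [IsProbabilityMeasure (distanceLaw c lam)]
    (hd : HasLaw d (volume.withDensity fun x =>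
      ENNReal.ofReal (2 * distanceCDF c lam x * distancePDF c lam x)) μ)
    (hα : 2 < α) (hc : 0 < c) (hlam : 0 < lam) (hP : 0 < P) (hρ : 0 ≤ ρ) (hs : 0 < s.re) :
    ‖averagingTerm μ d α lam σ P ρ u s
        - interferenceLimitedTerm α c (interferenceCoeff α (ρ / P) u) s‖ ≤
      4 * c * lam * Real.pi * ‖u‖ ^ 2 * ‖s‖ *
        (∫ t : ℝ in Ioi 0, t ^ (α / 2) * Real.exp (-(Real.pi * lam * c * t))) * (σ ^ 2 / P) := by
  have hπ := Real.pi_pos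
  have hω := interferenceCoeff_nonneg (u := u) hα (div_nonneg hρ hP.le)
  have hc2 : 0 < 2 * c := by positivity
  have h1 := add_mul_cpow_ne_zero hα hc hω hs
  have h2 := add_mul_cpow_ne_zero hα hc2 hω hs
  have hν : 0 ≤ filteredNoise σ u / P := by unfold filteredNoise; positivity
  have hw : 0 ≤ (((filteredNoise σ u / P : ℝ) : ℂ) * s).re := by
    rw [re_ofReal_mul]; exact mul_nonneg hν hs.le
  -- One lower bound `πλc` on the real parts serves both `c' = c` and `c' = 2c`, whatever `ω ≥ 0`
  -- is.
  have hA : ∀ c' : ℝ, c ≤ c' → Real.pi * lam * c ≤ (((Real.pi * lam : ℝ) : ℂ) *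
      ((c' : ℂ) + interferenceCoeff α (ρ / P) u * s ^ ((2 / α : ℝ) : ℂ))).re := fun c' hc' => by
    rw [re_ofReal_mul]
    have := hc'.trans (le_re_add_mul_cpow (c' := c') hα hω hs)
    gcongr
  have hb : ∀ c' : ℝ, c ≤ c' → _ := fun c' hc' => norm_stretchedLaplace_sub_inv_le
    (β := α / 2) (by linarith) (by positivity : 0 < Real.pi * lam * c) (hA c' hc') hw
  have hb1 := hb c le_rfl
  have hb2 := hb (2 * c) (by linarith)
  rw [norm_mul, Complex.norm_of_nonneg hν] at hb1 hb2
  set M := ∫ t : ℝ in Ioi 0, t ^ (α / 2) * Real.exp (-(Real.pi * lam * c * t))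
  rw [averagingTerm_eq hd hα hc hlam hP hρ hs]
  have hlim : interferenceLimitedTerm α c (interferenceCoeff α (ρ / P) u) s =
      (2 * c * lam * Real.pi : ℂ) * (((Real.pi * lam : ℝ) *
          ((c : ℂ) + interferenceCoeff α (ρ / P) u * s ^ ((2 / α : ℝ) : ℂ)))⁻¹ -
        ((Real.pi * lam : ℝ) *
          (((2 * c : ℝ) : ℂ) + interferenceCoeff α (ρ / P) u * s ^ ((2 / α : ℝ) : ℂ)))⁻¹) := by
    have h3 : (lam : ℂ) ≠ 0 := ofReal_ne_zero.2 hlam.ne'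
    have h4 : (Real.pi : ℂ) ≠ 0 := ofReal_ne_zero.2 hπ.ne'
    rw [interferenceLimitedTerm]
    push_cast at h1 h2 ⊢
    field_simp
  rw [hlim, ← mul_sub, sub_sub_sub_comm, norm_mul]
  have hconst : ‖(2 * c * lam * Real.pi : ℂ)‖ = 2 * c * lam * Real.pi := by
    rw [← Complex.norm_of_nonneg (by positivity : 0 ≤ 2 * c * lam * Real.pi)]
    push_cast
    rfl
  rw [hconst]
  -- The two transforms contribute the same error bound, hence the constant `4c`.
  calc _ ≤ 2 * c * lam * Real.pi * (filteredNoise σ u / P * ‖s‖ * M +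
        filteredNoise σ u / P * ‖s‖ * M) := by
        gcongr
        exact (norm_sub_le _ _).trans (add_le_add hb1 hb2)
    _ = _ := by rw [filteredNoise]; ring

end AveragingTerm

/-! ### The theorem assembled from the three strands. -/

theorem theorem1 {Ω : Type*} [MeasurableSpace Ω] (μ : Measure Ω) [IsProbabilityMeasure μ]
    -- parameters of the network
    (K N : ℕ) (c lam α : ℝ) (hc : 0 < c) (hlam : 0 < lam) (hα : 2 < α)
    -- detection filter of the far user
    (u : EuclideanSpace ℂ (Fin N)) (hu : u ≠ 0)
    -- independent, identically distributed distances of the `2K` users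
    (D : Fin (2 * K) → Ω → ℝ) (hDlaw : ∀ i, HasLaw (D i) (distanceLaw c lam) μ)
    (hDind : iIndepFun D μ)
    -- random grouping: uniform, and independent of the distances
    (G : Ω → Grouping K) (hG : HasLaw G (uniformOn Set.univ) μ)
    (hGD : IndepFun G (fun w i => D i w) μ)
    (k : Fin K) :
    -- the distribution function of the distance, and the density of the far-user distance
    (∀ x : ℝ, 0 ≤ x → distanceCDF c lam x = 1 - Real.exp (-(c * lam * Real.pi * x ^ 2))) ∧
    HasLaw (farDistance G D k)
      (volume.withDensity fun x =>
        ENNReal.ofReal (2 * distanceCDF c lam x * distancePDF c lam x)) μ ∧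
    ∀ s : ℂ, 0 < s.re →
      -- the averaging term through Fox's H-function
      (∀ σ P ρ : ℝ, 0 < σ → 0 < P → 0 ≤ ρ →
        let ω : ℝ := interferenceCoeff α (ρ / P) u
        let a : Fin 1 → ℂ × ℝ := ![(0, α / 2)]
        let b : Fin 1 → ℂ × ℝ := ![(0, 1)]
        let z₁ : ℂ := foxArgument α lam (filteredNoise σ u / P) c ω s
        let z₂ : ℂ := foxArgument α lam (filteredNoise σ u / P) (2 * c) ω s
        Integrable (fun w => averagingIntegrand α lam σ P ρ u s (farDistance G D k w)) μ ∧
        HasFoxH 1 1 a b z₁ (foxH 1 1 a b z₁) ∧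
        HasFoxH 1 1 a b z₂ (foxH 1 1 a b z₂) ∧
        (c : ℂ) + ω * s ^ ((2 / α : ℝ) : ℂ) ≠ 0 ∧
        2 * (c : ℂ) + ω * s ^ ((2 / α : ℝ) : ℂ) ≠ 0 ∧
        averagingTerm μ (farDistance G D k) α lam σ P ρ u s
          = 2 * c / (c + ω * s ^ ((2 / α : ℝ) : ℂ)) * foxH 1 1 a b z₁
            - 2 * c / (2 * c + ω * s ^ ((2 / α : ℝ) : ℂ)) * foxH 1 1 a b z₂) ∧
      -- the interference-limited regime, with the ratio `r` of `ρ` to `P` (hence `ω`) held fixed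
      (∀ r : ℝ, 0 ≤ r →
        Tendsto (fun x : ℝ × ℝ =>
            averagingTerm μ (farDistance G D k) α lam x.1 x.2 (r * x.2) u s)
          interferenceLimited
          (𝓝 (interferenceLimitedTerm α c (interferenceCoeff α r u) s))) ∧
      -- and uniformly in `P` and `ρ`
      (∀ ε : ℝ, 0 < ε → ∃ δ : ℝ, 0 < δ ∧
        ∀ σ P ρ : ℝ, 0 < σ → 0 < P → 0 ≤ ρ → σ ^ 2 / P < δ →
          ‖averagingTerm μ (farDistance G D k) α lam σ P ρ u s
            - interferenceLimitedTerm α c (interferenceCoeff α (ρ / P) u) s‖ < ε) := by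
  -- The pair `k` forces `K > 0`, so user `0` exists, and the law of its distance has total mass
  -- one.
  have : IsProbabilityMeasure (distanceLaw c lam) :=
    (hDlaw ⟨0, by have := k.pos; omega⟩).isProbabilityMeasure_iff.1 inferInstance
  have hlaw := hasLaw_farDistance hc hlam hDlaw hDind hG.aemeasurable hGD k
  -- The bound `1` on the integrand is available for nonnegative distances.
  have hdist : ∀ᵐ w ∂μ, 0 ≤ farDistance G D k w := by
    have h0 : (volume.withDensity fun x => ENNReal.ofReal
        (2 * distanceCDF c lam x * distancePDF c lam x)) (Set.Iic 0) = 0 :=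
      withDensity_Iic_eq_zero (fun x hx => by rw [distancePDF_of_nonpos hx, mul_zero]) le_rfl
    rw [← hlaw.map_eq, Measure.map_apply_of_aemeasurable hlaw.aemeasurable measurableSet_Iic] at h0
    filter_upwards [measure_eq_zero_iff_ae_notMem.1 h0] with w hw
    exact (not_le.1 hw).le
  refine ⟨fun x hx => distanceCDF_eq hc hlam hx, hlaw, fun s hs => ?_⟩
  have hunif : ∀ ε : ℝ, 0 < ε → ∃ δ : ℝ, 0 < δ ∧
      ∀ σ P ρ : ℝ, 0 < σ → 0 < P → 0 ≤ ρ → σ ^ 2 / P < δ →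
        ‖averagingTerm μ (farDistance G D k) α lam σ P ρ u s
          - interferenceLimitedTerm α c (interferenceCoeff α (ρ / P) u) s‖ < ε := by
    intro ε hε
    set M := 4 * c * lam * Real.pi * ‖u‖ ^ 2 * ‖s‖ *
      ∫ t : ℝ in Set.Ioi 0, t ^ (α / 2) * Real.exp (-(Real.pi * lam * c * t)) with hM
    have hM0 : 0 ≤ M := by
      have hpi := Real.pi_pos
      refine mul_nonneg (by positivity) (setIntegral_nonneg measurableSet_Ioi fun t ht => ?_)
      exact mul_nonneg (Real.rpow_nonneg (le_of_lt ht) _) (Real.exp_pos _).le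
    -- `M` depends on neither `σ`, `P` nor `ρ`; `M + 1` avoids a division by zero.
    refine ⟨ε / (M + 1), by positivity, fun σ P ρ hσ hP hρ hlt => ?_⟩
    refine (norm_averagingTerm_sub_le hlaw hα hc hlam hP hρ hs).trans_lt ?_
    rw [← hM]
    rw [lt_div_iff₀ (by positivity)] at hlt
    have : 0 < σ ^ 2 / P := by positivity
    linarith
  refine ⟨fun σ P ρ hσ hP hρ => ?_, fun r hr => ?_, hunif⟩
  · intro ω a b z₁ z₂
    have hω : 0 ≤ ω := interferenceCoeff_nonneg hα (div_nonneg hρ hP.le)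
    have hν := div_pos (filteredNoise_pos hu hσ) hP
    have h1 := hasFoxH_foxArgument hα hlam hc hω hν hs
    have h2 := hasFoxH_foxArgument hα hlam (by positivity : 0 < 2 * c) hω hν hs
    refine ⟨?_, ?_, ?_, add_mul_cpow_ne_zero hα hc hω hs, ?_,
      averagingTerm_eq_foxH hlaw hα hc hlam hu hσ hP hρ hs⟩
    · refine Integrable.of_bound
        (measurable_averagingIntegrand.comp_aemeasurable hlaw.aemeasurable).aestronglyMeasurable 1 ?_
      filter_upwards [hdist] with w hw
      exact norm_averagingIntegrand_le_one hα hlam hP hρ hs hw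
    · exact h1.foxH_eq.symm ▸ h1
    · exact h2.foxH_eq.symm ▸ h2
    · simpa using add_mul_cpow_ne_zero hα (by positivity : 0 < 2 * c) hω hs
  · refine Metric.tendsto_nhds.2 fun ε hε => ?_
    obtain ⟨δ, hδ, h⟩ := hunif ε hε
    have hsmall : ∀ᶠ x : ℝ × ℝ in interferenceLimited, x.1 ^ 2 / x.2 < δ :=
      (tendsto_comap.eventually (gt_mem_nhds hδ)).filter_mono inf_le_left
    have hpos : ∀ᶠ x : ℝ × ℝ in interferenceLimited, 0 < x.1 ∧ 0 < x.2 :=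
      (eventually_principal.2 fun _ hx => hx).filter_mono inf_le_right
    filter_upwards [hsmall, hpos] with x hx hx0
    -- With `ρ = r P` the ratio `ρ / P` is `r`, so the uniform statement has a fixed limit.
    have := h x.1 x.2 (r * x.2) hx0.1 hx0.2 (mul_nonneg hr hx0.2.le) hx
    rwa [mul_div_cancel_right₀ _ hx0.2.ne', ← dist_eq_norm] at this
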